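/- Let $\mathbb{H}$ be the quaternions and $\mathbb{B}=\{q\in\mathbb{H}: |q|<1\}$. A function $f:\mathbb{B}\to\mathbb{H}$ is (slice) regular if for every $I\in\mathbb{H}$ with $I^2=-1$ its restriction to $\mathbb{B}\cap(\mathbb{R}+I\mathbb{R})$ is real differentiable and satisfies $\frac12\left(\frac{\partial}{\partial x}+I\frac{\partial}{\partial y}\right)f(x+Iy)=0$; equivalently, $f(q)=\sum_{n\ge0}q^na_n$ on $\mathbb{B}$ with (unique) $a_n\in\mathbb{H}$. For regular $f=\sum q^na_n$, $g=\sum q^nb_n$ put $$f*g(q)=\sum_{n\ge0}q^n\sum_{k=0}^na_kb_{n-k},\qquad f^c(q)=\sum_{n\ge0}q^n\bar a_n,\qquad f^s=f*f^c,$$ and, where $f^s(q)\neq0$, $f^{-*}*g(q)=f^s(q)^{-1}\,(f^c*g)(q)$, $g*f^{-*}(q)=f^s(q)^{-1}\,(g*f^c)(q)$, $f^{-*}=f^{-*}*1$. In such expressions a quaternion stands for the constant function and $q$ for the variable. For $q_0\in\mathbb{B}$ let $\mathcal{M}_{q_0}(q)=(q-q_0)*(1-q\bar q_0)^{-*}$,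 and for regular $f:\mathbb{B}\to\mathbb{H}$ let $R_{q_0}f$ be the regular function on $\mathbb{B}$ that extends $(q-q_0)^{-*}*(f(q)-f(q_0))$. Write $x_0=\mathrm{Re}\,q_0$, $y_0=|\mathrm{Im}\,q_0|$, let $(R_{\bar q_0}R_{q_0})^k$ be the $k$-th iterate of the composition $R_{\bar q_0}R_{q_0}$, and let $$A_{2k}=(R_{\bar q_0}R_{q_0})^kf(q_0),\qquad A_{2k+1}=R_{q_0}(R_{\bar q_0}R_{q_0})^kf(\bar q_0)\qquad(k\ge0),$$ which are the coefficients of the spherical expansion $f(q)=\sum_{k\ge0}[(q-x_0)^2+y_0^2]^k\,[A_{2k}+(q-q_0)A_{2k+1}]$ of $f$ at $q_0$. **Theorem.** Let $f:\mathbb{B}\to\mathbb{B}$ be a regular function, let $q_0\in\mathbb{B}$ and let $n\ge1$ be an integer. If $A_m=0$ for all $1\le m\le 2n-1$, then for all $q\in\mathbb{B}$ $$\left|(f(q)-f(q_0))*(1-\overline{f(q_0)}*f(q))^{-*}\right|\le|\mathcal{M}^s_{q_0}(q)|^n,$$ $$\left|(R_{\bar q_0}R_{q_0})^nf(q)*(1-\overline{f(q_0)}*f(q))^{-*}\right|\le\left|(1-qx_0)^2+(qy_0)^2\right|^{-n}.$$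 If moreover $A_{2n}=0$, then for all $q\in\mathbb{B}$ $$\left|(f(q)-f(q_0))*(1-\overline{f(q_0)}*f(q))^{-*}\right|\le|\mathcal{M}^s_{q_0}(q)|^n\,|\mathcal{M}_{q_0}(q)|,$$ $$\left|R_{q_0}(R_{\bar q_0}R_{q_0})^nf(q)*(1-\overline{f(q_0)}*f(q))^{-*}\right|\le\left|(1-qx_0)^2+(qy_0)^2\right|^{-n}\cdot\left|(1-q\bar q_0)^{-*}\right|.$$ -/

import Mathlib

open scoped Quaternion

noncomputable section

namespace SliceRegularBall

/-- The open unit ball of the quaternions. -/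
def unitBall : Set ℍ[ℝ] := Metric.ball 0 1

/-- `f` is slice regular on the unit ball: for every imaginary unit `I`, the restriction of `f` to
the disc `{x + I y} ∩ 𝔹` is real differentiable and `½ (∂/∂x + I ∂/∂y) f (x + I y) = 0` there.
(Values of `f` outside the ball play no role.) -/
def SliceRegular (f : ℍ[ℝ] → ℍ[ℝ]) : Prop :=
  ∀ I : ℍ[ℝ], I ^ 2 = -1 → ∀ x y : ℝ, (x : ℍ[ℝ]) + I * (y : ℍ[ℝ]) ∈ unitBall →
    DifferentiableAt ℝ (fun p : ℝ × ℝ => f ((p.1 : ℍ[ℝ]) + I * (p.2 : ℍ[ℝ]))) (x, y) ∧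
    (1 / 2 : ℝ) • (deriv (fun s : ℝ => f ((s : ℍ[ℝ]) + I * (y : ℍ[ℝ]))) x
      + I * deriv (fun t : ℝ => f ((x : ℍ[ℝ]) + I * (t : ℍ[ℝ]))) y) = 0

/-- `f(q) = ∑ qⁿ aₙ` on the unit ball. -/
def HasPowerSeries (f : ℍ[ℝ] → ℍ[ℝ]) (a : ℕ → ℍ[ℝ]) : Prop :=
  ∀ q ∈ unitBall, HasSum (fun n : ℕ => q ^ n * a n) (f q)

open Classical in
/-- The coefficients of the power series of `f` on the unit ball
(they are unique; the value is `0` if `f` has no power series, i.e. is not slice regular). -/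
def coeff (f : ℍ[ℝ] → ℍ[ℝ]) : ℕ → ℍ[ℝ] :=
  if h : ∃ a, HasPowerSeries f a then h.choose else 0

/-- Regular multiplication: `f * g (q) = ∑ₙ qⁿ ∑_{k ≤ n} a_k b_{n-k}`. -/
def regMul (f g : ℍ[ℝ] → ℍ[ℝ]) (q : ℍ[ℝ]) : ℍ[ℝ] :=
  ∑' n : ℕ, q ^ n * ∑ k ∈ Finset.range (n + 1), coeff f k * coeff g (n - k)

/-- Regular conjugate: `f^c (q) = ∑ₙ qⁿ \bar aₙ`. -/
def regConj (f : ℍ[ℝ] → ℍ[ℝ]) (q : ℍ[ℝ]) : ℍ[ℝ] :=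
  ∑' n : ℕ, q ^ n * star (coeff f n)

/-- Symmetrization: `f^s = f * f^c`. -/
def symmetrization (f : ℍ[ℝ] → ℍ[ℝ]) : ℍ[ℝ] → ℍ[ℝ] :=
  regMul f (regConj f)

/-- Left regular quotient: `f^{-*} * g (q) = f^s(q)⁻¹ (f^c * g)(q)`, meaningful where
`f^s(q) ≠ 0`. -/
def leftQuot (f g : ℍ[ℝ] → ℍ[ℝ]) (q : ℍ[ℝ]) : ℍ[ℝ] :=
  (symmetrization f q)⁻¹ * regMul (regConj f) g q

/-- Right regular quotient: `g * h^{-*} (q) = h^s(q)⁻¹ (g * h^c)(q)`, meaningful where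
`h^s(q) ≠ 0`. -/
def rightQuot (g h : ℍ[ℝ] → ℍ[ℝ]) (q : ℍ[ℝ]) : ℍ[ℝ] :=
  (symmetrization h q)⁻¹ * regMul g (regConj h) q

/-- Regular reciprocal: `f^{-*} = f^{-*} * 1`. -/
def regRecip (f : ℍ[ℝ] → ℍ[ℝ]) : ℍ[ℝ] → ℍ[ℝ] :=
  leftQuot f (fun _ => 1)

/-- `g` is a slice regular function on the unit ball that coincides with the left regular quotient
`(q - q₀)^{-*} * (f(q) - f(q₀))` wherever the latter is defined, that is, off the zero set of
`(q - q₀)^s`. -/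
def IsDiffQuot (q₀ : ℍ[ℝ]) (f g : ℍ[ℝ] → ℍ[ℝ]) : Prop :=
  SliceRegular g ∧ ∀ q ∈ unitBall, symmetrization (fun p => p - q₀) q ≠ 0 →
    g q = leftQuot (fun p => p - q₀) (fun p => f p - f q₀) q

open Classical in
/-- The differential quotient `R_{q₀} f (q) = (q - q₀)^{-*} * (f(q) - f(q₀))`, as a slice regular
function on the whole unit ball (it exists and is unique on the ball when `f` is slice regular and
`q₀` is in the ball). -/
def diffQuot (q₀ : ℍ[ℝ]) (f : ℍ[ℝ] → ℍ[ℝ]) : ℍ[ℝ] → ℍ[ℝ] :=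
  if h : ∃ g, IsDiffQuot q₀ f g then h.choose else 0

/-- The iterates `(R_{\bar q₀} R_{q₀})ⁿ f`. -/
def iterDiffQuot (q₀ : ℍ[ℝ]) (n : ℕ) (f : ℍ[ℝ] → ℍ[ℝ]) : ℍ[ℝ] → ℍ[ℝ] :=
  (fun g => diffQuot (star q₀) (diffQuot q₀ g))^[n] f

/-- The coefficients of the spherical expansion
`f(q) = ∑ₖ [(q - x₀)² + y₀²]ᵏ [A_{2k} + (q - q₀) A_{2k+1}]`, namely
`A_{2k} = (R_{\bar q₀} R_{q₀})ᵏ f (q₀)` and `A_{2k+1} = R_{q₀} (R_{\bar q₀} R_{q₀})ᵏ f (\bar q₀)`. -/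
def sphericalCoeff (f : ℍ[ℝ] → ℍ[ℝ]) (q₀ : ℍ[ℝ]) (m : ℕ) : ℍ[ℝ] :=
  if Even m then iterDiffQuot q₀ (m / 2) f q₀
  else diffQuot q₀ (iterDiffQuot q₀ (m / 2) f) (star q₀)

/-- The regular Möbius transformation `𝓜_{q₀}(q) = (q - q₀) * (1 - q \bar q₀)^{-*}`. -/
def mobius (q₀ : ℍ[ℝ]) : ℍ[ℝ] → ℍ[ℝ] :=
  rightQuot (fun q => q - q₀) (fun q => 1 - q * star q₀)

/-- The function `1 - \overline{f(q₀)} * f(q)`, with the regular product. -/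
def schwarzDenom (f : ℍ[ℝ] → ℍ[ℝ]) (q₀ : ℍ[ℝ]) (q : ℍ[ℝ]) : ℍ[ℝ] :=
  1 - regMul (fun _ => star (f q₀)) f q

end SliceRegularBall

end

open SliceRegularBall

/-!
The regular product is the product of power series with a central variable, and it satisfies
`(f * g)(q) = f(q) g(f(q)⁻¹ q f(q))`. The point `f(q)⁻¹ q f(q)` has the same norm as `q`, so bounds
for `g` on spheres centred at `0` pass to `f * g`. This gives the Schwarz-Pick lemma: the function
`F = (f - f(q₀)) * (1 - \overline{f(q₀)} * f)^{-*}` is bounded by `1`. The vanishing of the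
coefficients `A_m` makes `F` divisible by `((q - q₀)^s)ⁿ`, respectively by
`((q - q₀)^s)ⁿ * (q - q₀)`. As in the Schwarz lemma, the maximum principle on spheres of radius
tending to `1` allows each factor `q - q₀` or `q - \bar q₀` of such a product to be replaced by
`1 - q \bar q₀` or `1 - q q₀`, which has the same modulus on the unit sphere, without losing the
bound `1`; dividing by the new factors gives the estimates.
-/

noncomputable section

namespace SliceRegularBall

section ConvergentSeries

variable {A : Type*} [NormedRing A]

variable (A) in
/-- The ring of power series over `A` that converge absolutely at every radius less than `1`.
The variable is central, so the product is the Cauchy product: this is the regular product. -/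
def convergentSeries : Subring (PowerSeries A) where
  carrier := {φ | ∀ r : ℝ, 0 ≤ r → r < 1 → Summable fun n => ‖PowerSeries.coeff n φ‖ * r ^ n}
  zero_mem' := by simp [summable_zero]
  one_mem' r _ _ := summable_of_ne_finset_zero (s := {0}) fun n hn => by
    simp_all [PowerSeries.coeff_one]
  neg_mem' hφ := by simpa using hφ
  add_mem' {φ ψ} hφ hψ r h0 h1 := by
    refine .of_nonneg_of_le (fun n => by positivity) (fun n => ?_) ((hφ r h0 h1).add (hψ r h0 h1))
    rw [← add_mul, map_add]
    gcongr
    exact norm_add_le _ _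
  mul_mem' {φ ψ} hφ hψ r h0 h1 := by
    refine .of_nonneg_of_le (fun n => by positivity) (fun n => ?_)
      (summable_norm_sum_mul_antidiagonal_of_summable_norm (hφ r h0 h1).norm (hψ r h0 h1).norm)
    rw [PowerSeries.coeff_mul, Real.norm_of_nonneg (Finset.sum_nonneg fun _ _ => by positivity)]
    refine (mul_le_mul_of_nonneg_right (norm_sum_le _ _) (by positivity)).trans ?_
    rw [Finset.sum_mul]
    refine Finset.sum_le_sum fun p hp => ?_
    rw [← Finset.HasAntidiagonal.mem_antidiagonal.mp hp, pow_add, mul_mul_mul_comm]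
    gcongr
    exact norm_mul_le _ _

variable (A) in
/-- The type of power series converging on the open unit ball of `A`. -/
abbrev RegularSeries : Type _ := convergentSeries A

lemma mem_convergentSeries_of_bounded {φ : PowerSeries A}
    (h : ∀ r : ℝ, 0 < r → r < 1 → ∃ M, ∀ n, ‖PowerSeries.coeff n φ‖ * r ^ n ≤ M) :
    φ ∈ convergentSeries A := by
  intro r hr₀ hr₁
  obtain ⟨s, hrs, hs₁⟩ := exists_between hr₁
  have hs₀ : 0 < s := hr₀.trans_lt hrs
  obtain ⟨M, hM⟩ := h s hs₀ hs₁
  refine .of_nonneg_of_le (fun n => by positivity) (fun n => ?_)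
    ((summable_geometric_of_lt_one (by positivity) ((div_lt_one hs₀).mpr hrs)).mul_left M)
  calc ‖PowerSeries.coeff n φ‖ * r ^ n
      = ‖PowerSeries.coeff n φ‖ * s ^ n * (r / s) ^ n := by
        rw [mul_assoc, ← mul_pow, mul_div_cancel₀ _ hs₀.ne']
    _ ≤ M * (r / s) ^ n := by gcongr; exact hM n

namespace RegularSeries

/-- Constants as convergent power series. -/
def C : A →+* RegularSeries A :=
  PowerSeries.C.codRestrict (convergentSeries A) fun a _ _ _ =>
    summable_of_ne_finset_zero (s := {0}) fun n hn => by simp_all [PowerSeries.coeff_C]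

/-- The identity function as a convergent power series. -/
def X : RegularSeries A :=
  ⟨PowerSeries.X, fun _ _ _ =>
    summable_of_ne_finset_zero (s := {1}) fun n hn => by simp_all [PowerSeries.coeff_X]⟩

@[simp] lemma coe_C (a : A) : (C a : PowerSeries A) = PowerSeries.C a := rfl

@[simp] lemma coe_X : (X : RegularSeries A) = (PowerSeries.X : PowerSeries A) := rfl

lemma commute_X (φ : RegularSeries A) : Commute X φ :=
  Subtype.ext (PowerSeries.commute_X φ.1).symm.eq

/-- The value of a power series at `q`, with the powers of `q` to the left of the coefficients. -/
def eval (φ : RegularSeries A) (q : A) : A :=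
  ∑' n, q ^ n * PowerSeries.coeff n φ.1

@[simp] lemma eval_C (a q : A) : eval (C a) q = a := by
  rw [eval, tsum_eq_single 0 fun n hn => by simp [PowerSeries.coeff_C, hn]]
  simp

@[simp] lemma eval_one (q : A) : eval 1 q = 1 := by
  simpa using eval_C 1 q

@[simp] lemma eval_X (q : A) : eval X q = q := by
  rw [eval, tsum_eq_single 1 fun n hn => by simp [PowerSeries.coeff_X, hn]]
  simp

variable [NormOneClass A]

lemma summable_norm (φ : RegularSeries A) {q : A} (hq : ‖q‖ < 1) :
    Summable fun n => ‖q ^ n * PowerSeries.coeff n φ.1‖ :=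
  .of_nonneg_of_le (fun _ => norm_nonneg _)
    (fun n => (norm_mul_le _ _).trans
      (by rw [mul_comm]; gcongr; exact norm_pow_le q n)) (φ.2 _ (norm_nonneg q) hq)

variable [CompleteSpace A]

lemma hasSum_eval (φ : RegularSeries A) {q : A} (hq : ‖q‖ < 1) :
    HasSum (fun n => q ^ n * PowerSeries.coeff n φ.1) (eval φ q) :=
  (φ.summable_norm hq).of_norm.hasSum

lemma eval_add (φ ψ : RegularSeries A) {q : A} (hq : ‖q‖ < 1) :
    eval (φ + ψ) q = eval φ q + eval ψ q := by
  simpa [eval, mul_add] using ((φ.hasSum_eval hq).add (ψ.hasSum_eval hq)).tsum_eq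

lemma eval_sub (φ ψ : RegularSeries A) {q : A} (hq : ‖q‖ < 1) :
    eval (φ - ψ) q = eval φ q - eval ψ q := by
  simpa [eval, mul_sub] using ((φ.hasSum_eval hq).sub (ψ.hasSum_eval hq)).tsum_eq

lemma eval_mul_C (φ : RegularSeries A) (a : A) {q : A} (hq : ‖q‖ < 1) :
    eval (φ * C a) q = eval φ q * a := by
  simpa [eval, mul_assoc] using ((φ.hasSum_eval hq).mul_right a).tsum_eq

lemma eval_mul_eq_tsum (φ ψ : RegularSeries A) {q : A} (hq : ‖q‖ < 1) :
    eval (φ * ψ) q = ∑' n, q ^ n * eval φ q * PowerSeries.coeff n ψ.1 := by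
  let F : ℕ × ℕ → A := fun p =>
    q ^ p.2 * (q ^ p.1 * PowerSeries.coeff p.1 φ.1) * PowerSeries.coeff p.2 ψ.1
  have hF : Summable F := by
    refine .of_norm_bounded ((φ.2 _ (norm_nonneg q) hq).mul_of_nonneg (ψ.2 _ (norm_nonneg q) hq)
      (fun _ => by positivity) fun _ => by positivity) fun p => ?_
    calc ‖F p‖ ≤ ‖q‖ ^ p.2 * (‖q‖ ^ p.1 * ‖PowerSeries.coeff p.1 φ.1‖)
          * ‖PowerSeries.coeff p.2 ψ.1‖ := by
          refine (norm_mul₃_le ..).trans ?_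
          gcongr
          · exact norm_pow_le q _
          · exact (norm_mul_le _ _).trans (by gcongr; exact norm_pow_le q _)
      _ = _ := by ring
  have hdiag : HasSum (fun n => ∑ p ∈ Finset.HasAntidiagonal.antidiagonal n, F p) (∑' p, F p) := by
    refine ((Finset.HasAntidiagonal.sigmaAntidiagonalEquivProd (A := ℕ)).hasSum_iff.mpr
      hF.hasSum).sigma fun n => ?_
    rw [← Finset.sum_coe_sort]
    exact hasSum_fintype _
  calc eval (φ * ψ) q = ∑' n, ∑ p ∈ Finset.HasAntidiagonal.antidiagonal n, F p := by
        refine tsum_congr fun n => ?_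
        rw [Subring.coe_mul, PowerSeries.coeff_mul, Finset.mul_sum]
        refine Finset.sum_congr rfl fun p hp => ?_
        rw [← Finset.HasAntidiagonal.mem_antidiagonal.mp hp, add_comm, pow_add]
        simp only [F, mul_assoc]
    _ = ∑' p, F p := hdiag.tsum_eq
    _ = ∑' n, ∑' m, F (m, n) := by
        rw [← (Equiv.prodComm ℕ ℕ).tsum_eq]
        exact ((Equiv.prodComm ℕ ℕ).summable_iff.mpr hF).tsum_prod
    _ = ∑' n, q ^ n * eval φ q * PowerSeries.coeff n ψ.1 := by
        refine tsum_congr fun n => ?_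
        have h := (φ.hasSum_eval hq).mul_left (q ^ n)
        exact (h.mul_right (PowerSeries.coeff n ψ.1)).tsum_eq

lemma eval_mul_of_semiconjBy (φ ψ : RegularSeries A) {p q : A} (hp : ‖p‖ < 1) (hq : ‖q‖ < 1)
    (h : SemiconjBy (eval φ q) p q) : eval (φ * ψ) q = eval φ q * eval ψ p := by
  rw [eval_mul_eq_tsum φ ψ hq, ← ((ψ.hasSum_eval hp).mul_left (eval φ q)).tsum_eq]
  exact tsum_congr fun n => by rw [← mul_assoc, (h.pow_right n).eq]

end RegularSeries

end ConvergentSeries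

section DivisionRing

variable {𝕜 : Type*} [NormedDivisionRing 𝕜] [CompleteSpace 𝕜]

namespace RegularSeries

lemma exists_norm_eq_forall_eval_mul (φ : RegularSeries 𝕜) {q : 𝕜} (hq : ‖q‖ < 1) :
    ∃ p, ‖p‖ = ‖q‖ ∧ ∀ ψ, eval (φ * ψ) q = eval φ q * eval ψ p := by
  by_cases hφ : eval φ q = 0
  · exact ⟨q, rfl, fun ψ => φ.eval_mul_of_semiconjBy ψ hq hq (by simp [hφ])⟩
  · have hp : ‖(eval φ q)⁻¹ * q * eval φ q‖ = ‖q‖ := by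
      rw [norm_mul, norm_mul, norm_inv, mul_right_comm, inv_mul_cancel₀ (norm_ne_zero_iff.mpr hφ),
        one_mul]
    -- The point `p` is `φ(q)⁻¹ q φ(q)`.
    refine ⟨_, hp, fun ψ => φ.eval_mul_of_semiconjBy ψ (hp.trans_lt hq) hq ?_⟩
    simp only [SemiconjBy, ← mul_assoc, mul_inv_cancel₀ hφ, one_mul]

lemma norm_eval_mul_le (φ ψ : RegularSeries 𝕜) {q : 𝕜} (hq : ‖q‖ < 1) {M : ℝ}
    (hM : ∀ p, ‖p‖ = ‖q‖ → ‖eval ψ p‖ ≤ M) : ‖eval (φ * ψ) q‖ ≤ ‖eval φ q‖ * M := by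
  obtain ⟨p, hp, hmul⟩ := φ.exists_norm_eq_forall_eval_mul hq
  rw [hmul ψ, norm_mul]
  gcongr
  exact hM p hp

end RegularSeries

end DivisionRing

section Conjugation

namespace RegularSeries

section Star

variable {A : Type*} [NormedRing A] [StarRing A] [NormedStarGroup A]

/-- Regular conjugation: the coefficients are conjugated and the variable is kept. -/
instance : StarRing (RegularSeries A) where
  star φ := ⟨PowerSeries.mk fun n => star (PowerSeries.coeff n φ.1), fun r h0 h1 => by
    simpa using φ.2 r h0 h1⟩
  star_involutive φ := Subtype.ext (PowerSeries.ext fun n => by simp)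
  star_mul φ ψ := Subtype.ext (PowerSeries.ext fun n => by
    simp only [Subring.coe_mul, PowerSeries.coeff_mk, PowerSeries.coeff_mul, star_sum, star_mul]
    exact Finset.Nat.sum_antidiagonal_swap (f := fun p : ℕ × ℕ =>
      star (PowerSeries.coeff p.1 ψ.1) * star (PowerSeries.coeff p.2 φ.1)))
  star_add φ ψ := Subtype.ext (PowerSeries.ext fun n => by simp)

@[simp] lemma coeff_star (φ : RegularSeries A) (n : ℕ) :
    PowerSeries.coeff n (star φ).1 = star (PowerSeries.coeff n φ.1) :=
  PowerSeries.coeff_mk n fun n => star (PowerSeries.coeff n φ.1)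

@[simp] lemma star_C (a : A) : star (C a) = C (star a) :=
  Subtype.ext (PowerSeries.ext fun n => by simp [PowerSeries.coeff_C, apply_ite star])

@[simp] lemma star_X : star (X : RegularSeries A) = X :=
  Subtype.ext (PowerSeries.ext fun n => by simp [PowerSeries.coeff_X, apply_ite star])

end Star

section SelfAdjoint

variable {σ : RegularSeries ℍ[ℝ]}

lemma exists_coeff_eq_of_isSelfAdjoint (hσ : IsSelfAdjoint σ) (n : ℕ) :
    ∃ x : ℝ, PowerSeries.coeff n σ.1 = x :=
  ⟨_, Quaternion.star_eq_self.mp (by rw [← coeff_star, hσ.star_eq])⟩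

lemma commute_of_isSelfAdjoint (hσ : IsSelfAdjoint σ) (φ : RegularSeries ℍ[ℝ]) :
    Commute σ φ := by
  ext1
  ext1 n
  rw [Subring.coe_mul, Subring.coe_mul, PowerSeries.coeff_mul, PowerSeries.coeff_mul,
    ← Finset.Nat.sum_antidiagonal_swap]
  refine Finset.sum_congr rfl fun p _ => ?_
  obtain ⟨x, hx⟩ := exists_coeff_eq_of_isSelfAdjoint hσ p.2
  rw [Prod.fst_swap, Prod.snd_swap, hx, Quaternion.coe_commutes]

lemma commute_eval_of_isSelfAdjoint (hσ : IsSelfAdjoint σ) (q : ℍ[ℝ]) : Commute (eval σ q) q := by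
  refine Commute.tsum_left q fun n => ?_
  obtain ⟨x, hx⟩ := exists_coeff_eq_of_isSelfAdjoint hσ n
  rw [hx]
  exact (Commute.pow_self q n).mul_left (Quaternion.coe_commute x q)

lemma eval_mul_of_isSelfAdjoint (hσ : IsSelfAdjoint σ) (ψ : RegularSeries ℍ[ℝ]) {q : ℍ[ℝ]}
    (hq : ‖q‖ < 1) : eval (σ * ψ) q = eval σ q * eval ψ q :=
  σ.eval_mul_of_semiconjBy ψ hq hq (commute_eval_of_isSelfAdjoint hσ q)

lemma eval_pow_of_isSelfAdjoint (hσ : IsSelfAdjoint σ) (n : ℕ) {q : ℍ[ℝ]} (hq : ‖q‖ < 1) :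
    eval (σ ^ n) q = eval σ q ^ n := by
  induction n with
  | zero => simp
  | succ n ih => rw [pow_succ', pow_succ', eval_mul_of_isSelfAdjoint hσ _ hq, ih]

end SelfAdjoint

section Symmetrization

variable (φ : RegularSeries ℍ[ℝ])

instance : IsStarNormal φ where
  star_comm_self := by
    -- `φ + φ^c` has real coefficients.
    have h := (commute_of_isSelfAdjoint (IsSelfAdjoint.add_star_self φ) φ).sub_left (.refl φ)
    rwa [add_sub_cancel_left] at h

/-- The symmetrization `φ ↦ φ * φ^c`; it is multiplicative because its values have real
coefficients and hence are central. -/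
def symm : RegularSeries ℍ[ℝ] →* RegularSeries ℍ[ℝ] where
  toFun φ := φ * star φ
  map_one' := by simp
  map_mul' φ ψ := by
    rw [star_mul, mul_assoc, ← mul_assoc ψ,
      (commute_of_isSelfAdjoint (IsSelfAdjoint.mul_star_self ψ) (star φ)).eq, mul_assoc]

lemma symm_apply : symm φ = φ * star φ := rfl

lemma isSelfAdjoint_symm : IsSelfAdjoint (symm φ) := .mul_star_self φ

lemma eval_symm_ne_zero_of_isUnit {φ : RegularSeries ℍ[ℝ]} (hφ : IsUnit φ) {q : ℍ[ℝ]}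
    (hq : ‖q‖ < 1) : eval (symm φ) q ≠ 0 := by
  obtain ⟨ψ, hψ⟩ := hφ.exists_right_inv
  refine left_ne_zero_of_mul_eq_one (b := eval (symm ψ) q) ?_
  rw [← eval_mul_of_isSelfAdjoint (isSelfAdjoint_symm φ) _ hq, ← map_mul, hψ, map_one, eval_one]

/-- Evaluate `φ^c * φ * ψ = φ^s * ψ` at `q`, which moves `φ * ψ` to a point of the same sphere. -/
lemma exists_eval_mul_eq {q : ℍ[ℝ]} (hq : ‖q‖ < 1) (h : eval (symm φ) q ≠ 0) :
    ∃ p, ‖p‖ = ‖q‖ ∧ eval φ p ≠ 0 ∧ ∀ ψ, eval (φ * ψ) p = eval φ p * eval ψ q := by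
  obtain ⟨p, hp, hmul⟩ := (star φ).exists_norm_eq_forall_eval_mul hq
  have hsymm : eval (symm φ) q = eval (star φ) q * eval φ p := by
    rw [← hmul, star_comm_self' φ, symm_apply]
  rw [hsymm] at h
  refine ⟨p, hp, right_ne_zero_of_mul h, fun ψ => mul_left_cancel₀ (left_ne_zero_of_mul h) ?_⟩
  rw [← mul_assoc, ← hsymm, ← hmul, ← eval_mul_of_isSelfAdjoint (isSelfAdjoint_symm φ) ψ hq,
    ← mul_assoc, star_comm_self' φ, symm_apply]

end Symmetrization

end RegularSeries

end Conjugation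

lemma eq_of_hasSum_pow_smul {𝕜 E : Type*} [NontriviallyNormedField 𝕜] [NormedAddCommGroup E]
    [NormedSpace 𝕜 E] {a b : ℕ → E} {f : 𝕜 → E}
    (ha : ∀ᶠ x in nhds 0, HasSum (fun n => x ^ n • a n) (f x))
    (hb : ∀ᶠ x in nhds 0, HasSum (fun n => x ^ n • b n) (f x)) : a = b := by
  let p (c : ℕ → E) : FormalMultilinearSeries 𝕜 𝕜 E := fun n =>
    ContinuousMultilinearMap.mkPiRing 𝕜 (Fin n) (c n)
  have hp (c : ℕ → E) (n : ℕ) : (p c).coeff n = c n := by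
    simp [p, FormalMultilinearSeries.coeff]
  have hasFPowerSeriesAt {c : ℕ → E} (hc : ∀ᶠ x in nhds 0, HasSum (fun n => x ^ n • c n) (f x)) :
      HasFPowerSeriesAt f (p c) 0 := hasFPowerSeriesAt_iff.mpr (by simpa only [hp, zero_add])
  funext n
  rw [← hp a, (hasFPowerSeriesAt ha).eq_formalMultilinearSeries (hasFPowerSeriesAt hb), hp]

section ComplexAnalysis

variable {E : Type*} [NormedAddCommGroup E] [NormedSpace ℂ E]

lemma differentiableAt_complex_iff_cauchyRiemann [NormedSpace ℝ E] [IsScalarTower ℝ ℂ E]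
    {g : ℂ → E} {x y : ℝ} :
    DifferentiableAt ℂ g (x + y * Complex.I) ↔
      DifferentiableAt ℝ (fun p : ℝ × ℝ => g (p.1 + p.2 * Complex.I)) (x, y) ∧
      deriv (fun s : ℝ => g (s + y * Complex.I)) x
        + Complex.I • deriv (fun t : ℝ => g (x + t * Complex.I)) y = 0 := by
  have hcoord : DifferentiableAt ℝ (fun p : ℝ × ℝ => g (p.1 + p.2 * Complex.I)) (x, y) ↔
      DifferentiableAt ℝ g (x + y * Complex.I) := by
    rw [← Complex.equivRealProdCLM_symm_apply (x, y)]
    refine Iff.trans ?_ Complex.equivRealProdCLM.symm.comp_right_differentiableAt_iff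
    simp only [Function.comp_def, Complex.equivRealProdCLM_symm_apply]
  have hpartial (hg : DifferentiableAt ℝ g (x + y * Complex.I)) :
      deriv (fun s : ℝ => g (s + y * Complex.I)) x = fderiv ℝ g (x + y * Complex.I) 1 ∧
      deriv (fun t : ℝ => g (x + t * Complex.I)) y
        = fderiv ℝ g (x + y * Complex.I) Complex.I :=
    ⟨(hg.hasFDerivAt.comp_hasDerivAt x (f := fun s : ℝ => (s : ℂ) + y * Complex.I)
        ((hasDerivAt_id x).ofReal_comp.add_const _)).deriv,
      (hg.hasFDerivAt.comp_hasDerivAt y (f := fun t : ℝ => (x : ℂ) + t * Complex.I)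
        ((((hasDerivAt_id y).ofReal_comp.mul_const Complex.I).const_add (x : ℂ)).congr_deriv
          (one_mul _))).deriv⟩
  rw [hcoord]
  constructor
  · intro hg
    have hgℝ := hg.restrictScalars ℝ
    refine ⟨hgℝ, ?_⟩
    rw [(hpartial hgℝ).1, (hpartial hgℝ).2, hg.fderiv_restrictScalars ℝ,
      ContinuousLinearMap.coe_restrictScalars', ← map_smul]
    simp
  · rintro ⟨hgℝ, hCR⟩
    rw [(hpartial hgℝ).1, (hpartial hgℝ).2] at hCR
    set L := fderiv ℝ g (x + y * Complex.I)
    have hLI : L Complex.I = Complex.I • L 1 := by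
      rw [eq_neg_of_add_eq_zero_left hCR, smul_neg, smul_smul, Complex.I_mul_I, neg_one_smul,
        neg_neg]
    refine (differentiableAt_iff_restrictScalars ℝ hgℝ).mpr
      ⟨.toSpanSingleton ℂ (L 1), ContinuousLinearMap.ext fun w => ?_⟩
    have hw : w = w.re • (1 : ℂ) + w.im • Complex.I := by simp
    have hLw : L w = w.re • L 1 + w.im • L Complex.I := by
      conv_lhs => rw [hw, map_add, map_smul, map_smul]
    change w • L 1 = L w
    rw [hLw, hLI]
    conv_lhs => rw [hw, add_smul, smul_assoc, smul_assoc, one_smul]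

lemma norm_iteratedDeriv_le_of_forall_mem_ball_norm_le [CompleteSpace E] {g : ℂ → E} {c : ℂ}
    {R M : ℝ} (hR : 0 < R)
    (hg : DifferentiableOn ℂ g (Metric.ball c R)) (hM : ∀ z ∈ Metric.ball c R, ‖g z‖ ≤ M) (n : ℕ) :
    ‖iteratedDeriv n g c‖ ≤ n.factorial * M / R ^ n := by
  have hbound : ∀ r ∈ Set.Ioo 0 R, ‖iteratedDeriv n g c‖ ≤ n.factorial * M / r ^ n := by
    rintro r ⟨hr, hrR⟩
    refine Complex.norm_iteratedDeriv_le_of_forall_mem_sphere_norm_le n hr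
      (DifferentiableOn.diffContOnCl (hg.mono ?_))
      fun z hz => hM z (Metric.sphere_subset_ball hrR hz)
    rw [closure_ball _ hr.ne']
    exact Metric.closedBall_subset_ball hrR
  have hlim : Filter.Tendsto (fun r : ℝ => n.factorial * M / r ^ n) (nhdsWithin R (Set.Iio R))
      (nhds (n.factorial * M / R ^ n)) :=
    (ContinuousAt.tendsto (by fun_prop (disch := positivity))).mono_left nhdsWithin_le_nhds
  exact ge_of_tendsto hlim (Filter.mem_of_superset (Ioo_mem_nhdsLT hR) hbound)

lemma hasSum_pow_smul_iteratedDeriv [CompleteSpace E] {g : ℂ → E} {R : ℝ}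
    (hg : DifferentiableOn ℂ g (Metric.ball 0 R)) {z : ℂ} (hz : z ∈ Metric.ball 0 R) :
    HasSum (fun n => z ^ n • (n.factorial : ℂ)⁻¹ • iteratedDeriv n g 0) (g z) := by
  simpa only [sub_zero, smul_comm (_ ^ _ : ℂ)] using Complex.hasSum_taylorSeries_on_ball hg hz

lemma norm_mul_pow_le_of_hasSum_pow_smul [CompleteSpace E] {g : ℂ → E} {a : ℕ → E} {R M : ℝ}
    (hR : 0 < R) (hg : DifferentiableOn ℂ g (Metric.ball 0 R))
    (ha : ∀ z ∈ Metric.ball 0 R, HasSum (fun n => z ^ n • a n) (g z))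
    (hM : ∀ z ∈ Metric.ball 0 R, ‖g z‖ ≤ M) (n : ℕ) : ‖a n‖ * R ^ n ≤ M := by
  have hball : Metric.ball (0 : ℂ) R ∈ nhds 0 := Metric.ball_mem_nhds 0 hR
  have htaylor : a = fun n => (n.factorial : ℂ)⁻¹ • iteratedDeriv n g 0 :=
    eq_of_hasSum_pow_smul (Filter.mem_of_superset hball ha)
      (Filter.mem_of_superset hball fun _ => hasSum_pow_smul_iteratedDeriv hg)
  have hfac : (0 : ℝ) < n.factorial := by positivity
  have hcauchy := norm_iteratedDeriv_le_of_forall_mem_ball_norm_le hR hg hM n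
  rw [mul_div_assoc, ← inv_mul_le_iff₀ hfac, le_div_iff₀ (by positivity)] at hcauchy
  simpa only [htaylor, norm_smul, norm_inv, Complex.norm_natCast] using hcauchy

end ComplexAnalysis

section Slices

variable (ι : ℂ →ₐ[ℝ] ℍ[ℝ])

lemma algHom_add_mul_I (x y : ℝ) : ι (x + y * Complex.I) = x + ι Complex.I * y := by
  rw [map_add, map_mul]
  exact congrArg₂ (· + ·) (ι.commutes x)
    ((congrArg (· * ι Complex.I) (ι.commutes y)).trans (Quaternion.coe_commutes y _))

lemma norm_algHom (z : ℂ) : ‖ι z‖ = ‖z‖ := by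
  have hsq : ι Complex.I ^ 2 = -1 := by rw [← map_pow, Complex.I_sq, map_neg, map_one]
  have hnorm : Quaternion.normSq (ι Complex.I) = 1 := by
    rw [← sq_eq_sq₀ Quaternion.normSq_nonneg zero_le_one, ← map_pow, hsq]
    simp
  have hre : (ι Complex.I).re = 0 := by
    rw [← Quaternion.sq_eq_neg_normSq, hsq, hnorm, Quaternion.coe_one]
  rw [← sq_eq_sq₀ (norm_nonneg _) (norm_nonneg _), ← Complex.re_add_im z, algHom_add_mul_I,
    sq, ← Quaternion.normSq_eq_norm_mul_self, Quaternion.normSq_add, map_mul, hnorm,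
    Complex.sq_norm, Complex.normSq_add_mul_I]
  simp [hre, Quaternion.normSq_coe]

lemma exists_algHom_I_eq {I : ℍ[ℝ]} (hI : I ^ 2 = -1) : ∃ ι : ℂ →ₐ[ℝ] ℍ[ℝ], ι Complex.I = I :=
  ⟨Complex.liftAux I (by rw [← sq, hI]), Complex.liftAux_apply_I I _⟩

lemma exists_algHom_apply_eq (q : ℍ[ℝ]) : ∃ (ι : ℂ →ₐ[ℝ] ℍ[ℝ]) (z : ℂ), ι z = q := by
  obtain ⟨I, hI, hq⟩ : ∃ I : ℍ[ℝ], I ^ 2 = -1 ∧ q.im = I * (‖q.im‖ : ℝ) := by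
    by_cases h : q.im = 0
    · refine ⟨Complex.I, ?_, by simp [h]⟩
      rw [sq, ← Quaternion.coeComplex_mul, Complex.I_mul_I]
      ext <;> simp
    · have hn : ‖q.im‖ ≠ 0 := norm_ne_zero_iff.mpr h
      refine ⟨‖q.im‖⁻¹ • q.im, ?_, ?_⟩
      · rw [smul_pow, Quaternion.im_sq, Quaternion.normSq_eq_norm_mul_self, smul_neg,
          ← Quaternion.coe_smul, smul_eq_mul, ← sq, ← mul_pow, inv_mul_cancel₀ hn]
        simp
      · rw [Quaternion.mul_coe_eq_smul, smul_smul, mul_inv_cancel₀ hn, one_smul]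
  obtain ⟨ι, hι⟩ := exists_algHom_I_eq hI
  exact ⟨ι, q.re + ‖q.im‖ * Complex.I, by
    rw [algHom_add_mul_I, hι, ← hq, Quaternion.re_add_im]⟩

/-- The complex structure on `ℍ` for which `ℂ` acts by left multiplication through `ι`. -/
abbrev sliceSpace : NormedSpace ℂ ℍ[ℝ] where
  toModule := Module.compHom ℍ[ℝ] ι.toRingHom
  norm_smul_le z q := by
    change ‖ι z * q‖ ≤ _
    rw [norm_mul, norm_algHom]

lemma sliceSpace_smul (z : ℂ) (q : ℍ[ℝ]) : letI := sliceSpace ι; z • q = ι z * q := rfl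

lemma sliceSpace_isScalarTower : letI := sliceSpace ι; IsScalarTower ℝ ℂ ℍ[ℝ] :=
  letI := sliceSpace ι
  ⟨fun x z q => by rw [sliceSpace_smul, sliceSpace_smul, map_smul, smul_mul_assoc]⟩

lemma sliceRegular_iff {f : ℍ[ℝ] → ℍ[ℝ]} :
    SliceRegular f ↔ ∀ ι : ℂ →ₐ[ℝ] ℍ[ℝ],
      letI := sliceSpace ι; DifferentiableOn ℂ (fun z => f (ι z)) (Metric.ball 0 1) := by
  have hCR (ι : ℂ →ₐ[ℝ] ℍ[ℝ]) (x y : ℝ) :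
      letI := sliceSpace ι
      DifferentiableAt ℂ (fun z => f (ι z)) (x + y * Complex.I) ↔
      DifferentiableAt ℝ (fun p : ℝ × ℝ => f (p.1 + ι Complex.I * p.2)) (x, y) ∧
      (1 / 2 : ℝ) • (deriv (fun s : ℝ => f (s + ι Complex.I * y)) x
        + ι Complex.I * deriv (fun t : ℝ => f (x + ι Complex.I * t)) y) = 0 := by
    let := sliceSpace ι
    have := sliceSpace_isScalarTower ι
    rw [differentiableAt_complex_iff_cauchyRiemann, smul_eq_zero_iff_right (by norm_num)]
    simp only [algHom_add_mul_I, sliceSpace_smul]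
  constructor
  · intro hf ι z hz
    let := sliceSpace ι
    rw [mem_ball_zero_iff, ← norm_algHom ι, ← mem_ball_zero_iff] at hz
    rw [← Complex.re_add_im z] at hz ⊢
    rw [algHom_add_mul_I] at hz
    exact ((hCR ι _ _).mpr (hf _ (by rw [← map_pow]; simp) _ _ hz)).differentiableWithinAt
  · intro hf I hI x y hxy
    obtain ⟨ι, rfl⟩ := exists_algHom_I_eq hI
    let := sliceSpace ι
    rw [← algHom_add_mul_I, unitBall, mem_ball_zero_iff, norm_algHom] at hxy
    exact (hCR ι x y).mp ((hf ι).differentiableAt (Metric.isOpen_ball.mem_nhds (by simpa)))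

end Slices

lemma eq_of_hasSum_coe_pow_mul {a b : ℕ → ℍ[ℝ]} {f : ℝ → ℍ[ℝ]}
    (ha : ∀ x : ℝ, |x| < 1 → HasSum (fun n => (x : ℍ[ℝ]) ^ n * a n) (f x))
    (hb : ∀ x : ℝ, |x| < 1 → HasSum (fun n => (x : ℍ[ℝ]) ^ n * b n) (f x)) : a = b := by
  have hnear : ∀ᶠ x : ℝ in nhds 0, |x| < 1 := by
    filter_upwards [Metric.ball_mem_nhds (0 : ℝ) one_pos] with x hx
    simpa using hx
  simp only [← Quaternion.coe_pow, Quaternion.coe_mul_eq_smul] at ha hb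
  exact eq_of_hasSum_pow_smul (hnear.mono ha) (hnear.mono hb)

section SliceEvaluation

variable (ι : ℂ →ₐ[ℝ] ℍ[ℝ])

namespace RegularSeries

lemma hasSum_eval_algHom (φ : RegularSeries ℍ[ℝ]) {z : ℂ} (hz : z ∈ Metric.ball 0 1) :
    letI := sliceSpace ι
    HasSum (fun n => z ^ n • PowerSeries.coeff n φ.1) (eval φ (ι z)) := by
  rw [mem_ball_zero_iff, ← norm_algHom ι] at hz
  simpa only [sliceSpace_smul, map_pow] using φ.hasSum_eval hz

lemma differentiableOn_eval_algHom (φ : RegularSeries ℍ[ℝ]) :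
    letI := sliceSpace ι
    DifferentiableOn ℂ (fun z => eval φ (ι z)) (Metric.ball 0 1) := by
  let := sliceSpace ι
  have hsmall {r : ℝ} (h0 : 0 ≤ r) (h1 : r < 1) :
      DifferentiableOn ℂ (fun z : ℂ => ∑' n, z ^ n • PowerSeries.coeff n φ.1)
        (Metric.ball 0 r) := by
    refine Complex.differentiableOn_tsum_of_summable_norm (φ.2 r h0 h1)
      (fun n => ((differentiable_id.pow n).smul_const _).differentiableOn) Metric.isOpen_ball
      fun n z hz => ?_
    rw [mem_ball_zero_iff] at hz
    rw [norm_smul, norm_pow, mul_comm]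
    gcongr
  intro z hz
  rw [mem_ball_zero_iff] at hz
  obtain ⟨r, hr, hr1⟩ := exists_between hz
  have hball : Metric.ball 0 r ∈ nhds z := Metric.isOpen_ball.mem_nhds (mem_ball_zero_iff.mpr hr)
  simpa only [eval, sliceSpace_smul, map_pow] using
    ((hsmall ((norm_nonneg z).trans hr.le) hr1).differentiableAt hball).differentiableWithinAt

lemma norm_eval_le_of_sphere (φ : RegularSeries ℍ[ℝ]) {ρ M : ℝ} (hρ : ρ < 1)
    (hM : ∀ p, ‖p‖ = ρ → ‖eval φ p‖ ≤ M) {q : ℍ[ℝ]} (hq : ‖q‖ < ρ) : ‖eval φ q‖ ≤ M := by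
  obtain ⟨ι, z, rfl⟩ := exists_algHom_apply_eq q
  let := sliceSpace ι
  rw [norm_algHom, ← mem_ball_zero_iff] at hq
  have hρ₀ : ρ ≠ 0 := (Metric.pos_of_mem_ball hq).ne'
  have hdiff : DiffContOnCl ℂ (fun z => eval φ (ι z)) (Metric.ball 0 ρ) := by
    refine (DifferentiableOn.mono (φ.differentiableOn_eval_algHom ι) ?_).diffContOnCl
    rw [closure_ball _ hρ₀]
    exact Metric.closedBall_subset_ball hρ
  refine Complex.norm_le_of_forall_mem_frontier_norm_le Metric.isBounded_ball hdiff
    (fun w hw => hM _ ?_) (subset_closure hq)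
  rw [frontier_ball _ hρ₀, mem_sphere_zero_iff_norm] at hw
  rw [norm_algHom, hw]

lemma norm_coeff_le (φ : RegularSeries ℍ[ℝ]) {M : ℝ}
    (hM : ∀ q, ‖q‖ < 1 → ‖eval φ q‖ ≤ M) (n : ℕ) : ‖PowerSeries.coeff n φ.1‖ ≤ M := by
  obtain ⟨ι, -, -⟩ := exists_algHom_apply_eq 0
  let := sliceSpace ι
  simpa only [one_pow, mul_one] using norm_mul_pow_le_of_hasSum_pow_smul one_pos
    (φ.differentiableOn_eval_algHom ι) (fun z => φ.hasSum_eval_algHom ι)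
    (fun z hz => hM _ (by rwa [norm_algHom, ← mem_ball_zero_iff])) n

lemma ext_of_eval_coe_eq {φ ψ : RegularSeries ℍ[ℝ]}
    (h : ∀ x : ℝ, |x| < 1 → eval φ x = eval ψ x) : φ = ψ := by
  refine Subtype.ext (PowerSeries.ext (congrFun (eq_of_hasSum_coe_pow_mul
    (f := fun x => eval φ x) (fun x hx => φ.hasSum_eval ?_) fun x hx => h x hx ▸ ψ.hasSum_eval ?_)))
  all_goals rwa [Quaternion.norm_coe]

end RegularSeries

lemma exists_regularSeries_of_differentiableOn {g : ℂ → ℍ[ℝ]}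
    (hg : letI := sliceSpace ι; DifferentiableOn ℂ g (Metric.ball 0 1)) :
    ∃ φ : RegularSeries ℍ[ℝ], ∀ z ∈ Metric.ball 0 1, φ.eval (ι z) = g z := by
  let := sliceSpace ι
  let a (n : ℕ) : ℍ[ℝ] := (n.factorial : ℂ)⁻¹ • iteratedDeriv n g 0
  have ha (z : ℂ) (hz : z ∈ Metric.ball 0 1) : HasSum (fun n => z ^ n • a n) (g z) :=
    hasSum_pow_smul_iteratedDeriv hg hz
  have hmem : PowerSeries.mk a ∈ convergentSeries ℍ[ℝ] := by
    refine mem_convergentSeries_of_bounded fun r hr₀ hr₁ => ?_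
    obtain ⟨M, hM⟩ := (isCompact_closedBall (0 : ℂ) r).exists_bound_of_continuousOn
      (hg.continuousOn.mono (Metric.closedBall_subset_ball hr₁))
    have hball : Metric.ball (0 : ℂ) r ⊆ Metric.ball 0 1 := Metric.ball_subset_ball hr₁.le
    refine ⟨M, fun n => ?_⟩
    rw [PowerSeries.coeff_mk]
    exact norm_mul_pow_le_of_hasSum_pow_smul hr₀ (hg.mono hball) (fun z hz => ha z (hball hz))
      (fun z hz => hM z (Metric.ball_subset_closedBall hz)) n
  refine ⟨⟨_, hmem⟩, fun z hz => (RegularSeries.hasSum_eval_algHom ι _ hz).unique ?_⟩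
  simpa only [PowerSeries.coeff_mk] using ha z hz

end SliceEvaluation

section Representation

lemma mem_unitBall {q : ℍ[ℝ]} : q ∈ unitBall ↔ ‖q‖ < 1 := mem_ball_zero_iff

lemma HasPowerSeries.unique {f : ℍ[ℝ] → ℍ[ℝ]} {a b : ℕ → ℍ[ℝ]} (ha : HasPowerSeries f a)
    (hb : HasPowerSeries f b) : a = b := by
  refine eq_of_hasSum_coe_pow_mul (f := fun x => f x) (fun x hx => ha x ?_) fun x hx => hb x ?_
  all_goals rwa [mem_unitBall, Quaternion.norm_coe]

/-- `f` is the sum of the convergent power series `φ` on the unit ball. Through this relation the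
operations on slice regular functions become ring operations on power series. -/
def Represents (φ : RegularSeries ℍ[ℝ]) (f : ℍ[ℝ] → ℍ[ℝ]) : Prop :=
  Set.EqOn f φ.eval unitBall

lemma represents_eval (φ : RegularSeries ℍ[ℝ]) : Represents φ φ.eval := Set.eqOn_refl _ _

lemma represents_const (a : ℍ[ℝ]) : Represents (.C a) fun _ => a :=
  fun q _ => (RegularSeries.eval_C a q).symm

lemma SliceRegular.exists_represents {f : ℍ[ℝ] → ℍ[ℝ]} (hf : SliceRegular f) :
    ∃ φ, Represents φ f := by
  choose φ hφ using fun ι => exists_regularSeries_of_differentiableOn ι (sliceRegular_iff.mp hf ι)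
  -- The slices share the real axis, where the coefficients can be read off.
  have hreal (ι : ℂ →ₐ[ℝ] ℍ[ℝ]) (x : ℝ) (hx : |x| < 1) : (φ ι).eval x = f x := by
    have h := hφ ι x (by simpa using hx)
    rwa [show ι x = x from ι.commutes x] at h
  obtain ⟨ι₀, -, -⟩ := exists_algHom_apply_eq 0
  refine ⟨φ ι₀, fun q hq => ?_⟩
  obtain ⟨ι, z, rfl⟩ := exists_algHom_apply_eq q
  rw [mem_unitBall, norm_algHom, ← mem_ball_zero_iff] at hq
  rw [← hφ ι z hq, RegularSeries.ext_of_eval_coe_eq fun x hx => (hreal ι x hx).trans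
    (hreal ι₀ x hx).symm]

namespace Represents

variable {φ ψ γ : RegularSeries ℍ[ℝ]} {f g : ℍ[ℝ] → ℍ[ℝ]}

lemma hasPowerSeries (hf : Represents φ f) :
    HasPowerSeries f fun n => PowerSeries.coeff n φ.1 := fun q hq => by
  rw [hf hq]
  exact φ.hasSum_eval (mem_unitBall.mp hq)

lemma sliceRegular (hf : Represents φ f) : SliceRegular f :=
  sliceRegular_iff.mpr fun ι =>
    letI := sliceSpace ι
    (φ.differentiableOn_eval_algHom ι).congr fun z hz =>
      hf (by rwa [mem_unitBall, norm_algHom, ← mem_ball_zero_iff])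

lemma coeff_eq (hf : Represents φ f) (n : ℕ) : coeff f n = PowerSeries.coeff n φ.1 := by
  have hex : ∃ a, HasPowerSeries f a := ⟨_, hf.hasPowerSeries⟩
  rw [coeff, dif_pos hex, hex.choose_spec.unique hf.hasPowerSeries]

lemma sub (hf : Represents φ f) (hg : Represents ψ g) :
    Represents (φ - ψ) fun q => f q - g q := fun q hq => by
  rw [φ.eval_sub ψ (mem_unitBall.mp hq), ← hf hq, ← hg hq]

lemma regMul_eq (hf : Represents φ f) (hg : Represents ψ g) : regMul f g = (φ * ψ).eval := by
  funext q
  simp only [regMul, RegularSeries.eval, Subring.coe_mul, PowerSeries.coeff_mul, hf.coeff_eq,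
    hg.coeff_eq, Finset.Nat.sum_antidiagonal_eq_sum_range_succ_mk]

lemma regMul (hf : Represents φ f) (hg : Represents ψ g) :
    Represents (φ * ψ) (SliceRegularBall.regMul f g) :=
  hf.regMul_eq hg ▸ represents_eval _

lemma regConj (hf : Represents φ f) : Represents (star φ) (SliceRegularBall.regConj f) :=
  fun q _ => by
    simp only [SliceRegularBall.regConj, RegularSeries.eval, hf.coeff_eq, RegularSeries.coeff_star]

lemma symmetrization_eq (hf : Represents φ f) :
    symmetrization f = (RegularSeries.symm φ).eval :=
  hf.regMul_eq hf.regConj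

lemma leftQuot_eq (hf : Represents φ f) (hg : Represents (φ * γ) g) {q : ℍ[ℝ]}
    (hq : q ∈ unitBall) (h : symmetrization f q ≠ 0) : leftQuot f g q = γ.eval q := by
  rw [leftQuot, inv_mul_eq_iff_eq_mul₀ h, hf.symmetrization_eq, hf.regConj.regMul_eq hg,
    ← RegularSeries.eval_mul_of_isSelfAdjoint (RegularSeries.isSelfAdjoint_symm φ) γ
      (mem_unitBall.mp hq), RegularSeries.symm_apply, ← mul_assoc, star_comm_self' φ]

lemma rightQuot_eq (hf : Represents φ f) (hg : Represents (γ * φ) g) {q : ℍ[ℝ]}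
    (hq : q ∈ unitBall) (h : symmetrization f q ≠ 0) : rightQuot g f q = γ.eval q := by
  rw [rightQuot, inv_mul_eq_iff_eq_mul₀ h, hf.symmetrization_eq, hg.regMul_eq hf.regConj,
    ← RegularSeries.eval_mul_of_isSelfAdjoint (RegularSeries.isSelfAdjoint_symm φ) γ
      (mem_unitBall.mp hq), mul_assoc, ← RegularSeries.symm_apply,
    (RegularSeries.commute_of_isSelfAdjoint (RegularSeries.isSelfAdjoint_symm φ) γ).eq]

section Units

variable {u : (RegularSeries ℍ[ℝ])ˣ}

lemma symmetrization_ne_zero_of_units (hf : Represents u f) {q : ℍ[ℝ]} (hq : q ∈ unitBall) :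
    symmetrization f q ≠ 0 := by
  rw [hf.symmetrization_eq]
  exact RegularSeries.eval_symm_ne_zero_of_isUnit u.isUnit (mem_unitBall.mp hq)

lemma rightQuot (hg : Represents φ g) (hf : Represents u f) :
    Represents (φ * ↑u⁻¹) (SliceRegularBall.rightQuot g f) := fun q hq =>
  hf.rightQuot_eq (by rwa [Units.inv_mul_cancel_right]) hq (hf.symmetrization_ne_zero_of_units hq)

lemma regRecip (hf : Represents u f) :
    Represents (↑u⁻¹ : RegularSeries ℍ[ℝ]) (SliceRegularBall.regRecip f) := fun q hq =>
  hf.leftQuot_eq (by rw [Units.mul_inv, ← map_one RegularSeries.C]; exact represents_const 1) hq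
    (hf.symmetrization_ne_zero_of_units hq)

end Units

end Represents

end Representation

section Inversion

namespace RegularSeries

lemma norm_eval_pow_le {𝕜 : Type*} [NormedDivisionRing 𝕜] [CompleteSpace 𝕜]
    (ψ : RegularSeries 𝕜) {ρ : ℝ} (hψ : ∀ q, ‖q‖ < 1 → ‖eval ψ q‖ ≤ ρ) (m : ℕ) {q : 𝕜}
    (hq : ‖q‖ < 1) : ‖eval (ψ ^ m) q‖ ≤ ρ ^ m := by
  have hρ : 0 ≤ ρ := (norm_nonneg _).trans (hψ q hq)
  induction m generalizing q with
  | zero => simp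
  | succ m ih =>
    rw [pow_succ', pow_succ']
    exact (ψ.norm_eval_mul_le _ hq fun p hp => ih (hp.trans_lt hq)).trans
      (mul_le_mul_of_nonneg_right (hψ q hq) (by positivity))

open scoped PowerSeries.WithPiTopology in
lemma isUnit_one_sub (ψ : RegularSeries ℍ[ℝ]) {ρ : ℝ} (hρ : ρ < 1)
    (hψ : ∀ q, ‖q‖ < 1 → ‖eval ψ q‖ ≤ ρ) : IsUnit (1 - ψ) := by
  have hρ₀ : 0 ≤ ρ := (norm_nonneg _).trans (hψ 0 (by simp))
  have hcoeff (m n : ℕ) : ‖PowerSeries.coeff n (ψ.1 ^ m)‖ ≤ ρ ^ m :=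
    norm_coeff_le (ψ ^ m) (fun q hq => ψ.norm_eval_pow_le hψ m hq) n
  have hgeom := hasSum_geometric_of_lt_one hρ₀ hρ
  have hsum : Summable fun m => ψ.1 ^ m :=
    (PowerSeries.WithPiTopology.summable_iff_summable_coeff _).mpr fun n =>
      hgeom.summable.of_norm_bounded fun m => hcoeff m n
  have hmem : ∑' m, ψ.1 ^ m ∈ convergentSeries ℍ[ℝ] := by
    refine mem_convergentSeries_of_bounded fun r hr₀ hr₁ => ⟨(1 - ρ)⁻¹, fun n => ?_⟩
    refine (mul_le_of_le_one_right (norm_nonneg _) (pow_le_one₀ hr₀.le hr₁.le)).trans ?_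
    rw [← ((PowerSeries.WithPiTopology.hasSum_iff_hasSum_coeff _).mp hsum.hasSum n).tsum_eq]
    exact tsum_of_norm_bounded hgeom fun m => hcoeff m n
  exact ⟨⟨1 - ψ, ⟨_, hmem⟩, Subtype.ext hsum.one_sub_mul_tsum_pow,
    Subtype.ext hsum.tsum_pow_mul_one_sub⟩, rfl⟩

end RegularSeries

end Inversion

section Division

namespace RegularSeries

variable {A : Type*} [NormedRing A]

/-- The series with coefficients `aₖ, aₖ₊₁, …`, where `a₀, a₁, …` are the coefficients of `φ`. -/
def shift (k : ℕ) (φ : RegularSeries A) : RegularSeries A :=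
  ⟨PowerSeries.mk fun m => PowerSeries.coeff (m + k) φ.1, fun r hr₀ hr₁ => by
    obtain ⟨s, hrs, hs₁⟩ := exists_between hr₁
    have hs₀ : 0 < s := hr₀.trans_lt hrs
    refine .of_nonneg_of_le (fun m => by positivity) (fun m => ?_)
      (((summable_nat_add_iff k).mpr (φ.2 s hs₀.le hs₁)).mul_right (s ^ k)⁻¹)
    rw [PowerSeries.coeff_mk, pow_add, ← mul_assoc, mul_inv_cancel_right₀ (pow_pos hs₀ k).ne']
    gcongr⟩

@[simp] lemma coeff_shift (k : ℕ) (φ : RegularSeries A) (m : ℕ) :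
    PowerSeries.coeff m (shift k φ).1 = PowerSeries.coeff (m + k) φ.1 :=
  PowerSeries.coeff_mk m fun m => PowerSeries.coeff (m + k) φ.1

lemma shift_zero (φ : RegularSeries A) : shift 0 φ = φ :=
  Subtype.ext (PowerSeries.ext fun n => coeff_shift 0 φ n)

/-- The series of the function `q ↦ q - a`. -/
def linFactor (a : A) : RegularSeries A := X - C a

variable [NormOneClass A]

lemma norm_eval_shift_mul_pow_le (k : ℕ) (φ : RegularSeries A) {q : A} {s : ℝ} (hqs : ‖q‖ ≤ s)
    (hs : s < 1) :
    ‖eval (shift k φ) q‖ * s ^ k ≤ ∑' n, ‖PowerSeries.coeff n φ.1‖ * s ^ n := by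
  have hs₀ : 0 ≤ s := (norm_nonneg q).trans hqs
  have hsum := φ.2 s hs₀ hs
  have hle : ‖eval (shift k φ) q‖ ≤ ∑' m, ‖PowerSeries.coeff (m + k) φ.1‖ * s ^ m := by
    refine tsum_of_norm_bounded (by simpa using ((shift k φ).2 s hs₀ hs).hasSum) fun m => ?_
    calc ‖q ^ m * PowerSeries.coeff m (shift k φ).1‖
        ≤ s ^ m * ‖PowerSeries.coeff (m + k) φ.1‖ := by
          rw [coeff_shift]
          refine (norm_mul_le _ _).trans ?_
          gcongr
          exact (norm_pow_le q m).trans (by gcongr)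
      _ = _ := mul_comm _ _
  calc ‖eval (shift k φ) q‖ * s ^ k
      ≤ (∑' m, ‖PowerSeries.coeff (m + k) φ.1‖ * s ^ m) * s ^ k := by gcongr
    _ = ∑' m, ‖PowerSeries.coeff (m + k) φ.1‖ * s ^ (m + k) := by
        simp only [← tsum_mul_right, mul_assoc, ← pow_add]
    _ ≤ ∑' n, ‖PowerSeries.coeff n φ.1‖ * s ^ n := by
        rw [← hsum.sum_add_tsum_nat_add k]
        exact le_add_of_nonneg_left (Finset.sum_nonneg fun _ _ => by positivity)

variable [CompleteSpace A]

lemma eval_shift (k : ℕ) (φ : RegularSeries A) {q : A} (hq : ‖q‖ < 1) :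
    eval (shift k φ) q = PowerSeries.coeff k φ.1 + q * eval (shift (k + 1) φ) q := by
  have hshift : HasSum (fun n => q * (q ^ n * PowerSeries.coeff n (shift (k + 1) φ).1))
      (q * eval (shift (k + 1) φ) q) := ((shift (k + 1) φ).hasSum_eval hq).mul_left q
  rw [eval, ((shift k φ).hasSum_eval hq).summable.tsum_eq_zero_add, ← hshift.tsum_eq]
  simp [pow_succ', mul_assoc, add_assoc, add_comm 1 k]

lemma exists_eq_C_add_linFactor_mul (φ : RegularSeries A) {a : A} (ha : ‖a‖ < 1) :
    ∃ γ, φ = C (eval φ a) + linFactor a * γ := by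
  have hmem : PowerSeries.mk (fun n => eval (shift (n + 1) φ) a) ∈ convergentSeries A := by
    refine mem_convergentSeries_of_bounded fun r hr₀ hr₁ => ?_
    set s := max r ‖a‖
    have hs : s < 1 := max_lt hr₁ ha
    have hs₀ : 0 < s := hr₀.trans_le (le_max_left _ _)
    refine ⟨(∑' n, ‖PowerSeries.coeff n φ.1‖ * s ^ n) * s⁻¹, fun n => ?_⟩
    rw [PowerSeries.coeff_mk]
    calc ‖eval (shift (n + 1) φ) a‖ * r ^ n
        ≤ ‖eval (shift (n + 1) φ) a‖ * s ^ n := by gcongr; exact le_max_left _ _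
      _ = ‖eval (shift (n + 1) φ) a‖ * s ^ (n + 1) * s⁻¹ := by
          rw [pow_succ, ← mul_assoc, mul_inv_cancel_right₀ hs₀.ne']
      _ ≤ _ := by
          gcongr
          exact norm_eval_shift_mul_pow_le _ φ (le_max_right _ _) hs
  refine ⟨⟨_, hmem⟩, Subtype.ext (PowerSeries.ext fun n => ?_)⟩
  rw [linFactor, sub_mul, Subring.coe_add, AddSubgroupClass.coe_sub, Subring.coe_mul,
    Subring.coe_mul, coe_X, coe_C, coe_C, map_add, map_sub, PowerSeries.coeff_C_mul,
    PowerSeries.coeff_C]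
  cases n with
  | zero =>
    have h := eval_shift 0 φ ha
    rw [shift_zero] at h
    simp [h]
  | succ n => simp [PowerSeries.coeff_succ_X_mul, eval_shift (n + 1) φ ha]

end RegularSeries

end Division

section Factors

namespace RegularSeries

/-- The series of the function `q ↦ 1 - q * star a`, the denominator of the Möbius transformation
centred at `a`. -/
def reflFactor (a : ℍ[ℝ]) : RegularSeries ℍ[ℝ] := 1 - X * C (star a)

lemma star_linFactor (a : ℍ[ℝ]) : star (linFactor a) = linFactor (star a) := by
  simp only [linFactor, star_sub, star_X, star_C]

lemma star_reflFactor (a : ℍ[ℝ]) : star (reflFactor a) = reflFactor (star a) := by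
  simp only [reflFactor, star_sub, star_one, star_mul, star_X, star_C, (commute_X _).eq]

lemma commute_linFactor_reflFactor {a b : ℍ[ℝ]} (h : Commute a (star b)) :
    Commute (linFactor a) (reflFactor b) := by
  have hC : Commute (C a) (X * C (star b)) := (commute_X (C a)).symm.mul_right (h.map C)
  exact (commute_X (reflFactor b)).sub_left ((Commute.one_right (C a)).sub_right hC)

lemma linFactor_ne_zero (a : ℍ[ℝ]) : linFactor a ≠ 0 := fun h => by
  simpa [linFactor] using congrArg (fun φ => PowerSeries.coeff 1 φ.1) h

lemma eval_linFactor (a : ℍ[ℝ]) {q : ℍ[ℝ]} (hq : ‖q‖ < 1) : eval (linFactor a) q = q - a := by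
  rw [linFactor, eval_sub _ _ hq, eval_X, eval_C]

lemma eval_reflFactor (a : ℍ[ℝ]) {q : ℍ[ℝ]} (hq : ‖q‖ < 1) :
    eval (reflFactor a) q = 1 - q * star a := by
  rw [reflFactor, eval_sub _ _ hq, eval_one, eval_mul_C _ _ hq, eval_X]

lemma isUnit_reflFactor {a : ℍ[ℝ]} (ha : ‖a‖ < 1) : IsUnit (reflFactor a) :=
  isUnit_one_sub _ ha fun q hq => by
    rw [eval_mul_C _ _ hq, eval_X, norm_mul, Quaternion.norm_star]
    exact mul_le_of_le_one_left (norm_nonneg a) hq.le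

lemma isSelfAdjoint_X_mul_C (x : ℝ) : IsSelfAdjoint (X * C (x : ℍ[ℝ])) := by
  rw [IsSelfAdjoint, star_mul, star_X, star_C, Quaternion.star_coe, (commute_X _).eq]

lemma symm_reflFactor (a : ℍ[ℝ]) :
    symm (reflFactor a) = (1 - X * C (a.re : ℍ[ℝ])) ^ 2 + (X * C (‖a.im‖ : ℍ[ℝ])) ^ 2 := by
  have hre : C a = C (a.re : ℍ[ℝ]) + C a.im := by rw [← map_add, Quaternion.re_add_im]
  have hre_star : C (star a) = C (a.re : ℍ[ℝ]) - C a.im := by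
    rw [← map_sub, sub_eq_add_neg, ← Quaternion.star_im, ← Quaternion.star_coe a.re, ← star_add,
      Quaternion.re_add_im]
  have hfactor : reflFactor a = 1 - X * C (a.re : ℍ[ℝ]) + X * C a.im := by
    rw [reflFactor, hre_star, mul_sub, sub_add]
  have hstar : star (reflFactor a) = 1 - X * C (a.re : ℍ[ℝ]) - X * C a.im := by
    rw [star_reflFactor, reflFactor, star_star, hre, mul_add, sub_add_eq_sub_sub]
  have hcomm : Commute (1 - X * C (a.re : ℍ[ℝ])) (X * C a.im) :=
    commute_of_isSelfAdjoint ((IsSelfAdjoint.one _).sub (isSelfAdjoint_X_mul_C _)) _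
  have him : (X * C a.im) ^ 2 = -(X * C (‖a.im‖ : ℍ[ℝ])) ^ 2 := by
    rw [(commute_X _).mul_pow, (commute_X _).mul_pow, ← map_pow, ← map_pow, Quaternion.im_sq,
      Quaternion.normSq_eq_norm_mul_self, ← mul_neg, ← map_neg, ← sq, Quaternion.coe_pow]
  rw [symm_apply, hstar, hfactor, ← hcomm.sq_sub_sq, him, sub_neg_eq_add]

lemma eval_symm_reflFactor (a : ℍ[ℝ]) {q : ℍ[ℝ]} (hq : ‖q‖ < 1) :
    eval (symm (reflFactor a)) q = (1 - q * a.re) ^ 2 + (q * ‖a.im‖) ^ 2 := by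
  have hX := isSelfAdjoint_X_mul_C
  rw [symm_reflFactor, eval_add _ _ hq, eval_pow_of_isSelfAdjoint (hX _) _ hq,
    eval_pow_of_isSelfAdjoint ((IsSelfAdjoint.one _).sub (hX _)) _ hq, eval_sub _ _ hq, eval_one,
    eval_mul_C _ _ hq, eval_mul_C _ _ hq, eval_X]

lemma eval_symm_linFactor_ne_zero {a q : ℍ[ℝ]} (ha : ‖a‖ < ‖q‖) (hq : ‖q‖ < 1) :
    eval (symm (linFactor a)) q ≠ 0 := by
  obtain ⟨p, hp, hmul⟩ := (linFactor a).exists_norm_eq_forall_eval_mul hq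
  rw [symm_apply, hmul, star_linFactor, eval_linFactor a hq,
    eval_linFactor _ (hp.trans_lt hq), mul_ne_zero_iff, sub_ne_zero, sub_ne_zero]
  refine ⟨ne_of_apply_ne norm ha.ne', ne_of_apply_ne norm ?_⟩
  rw [hp, Quaternion.norm_star]
  exact ha.ne'

end RegularSeries

open RegularSeries

variable {a : ℍ[ℝ]}

lemma represents_linFactor (a : ℍ[ℝ]) : Represents (linFactor a) fun q => q - a :=
  fun _ hq => (eval_linFactor a (mem_unitBall.mp hq)).symm

lemma represents_reflFactor (a : ℍ[ℝ]) : Represents (reflFactor a) fun q => 1 - q * star a :=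
  fun _ hq => (eval_reflFactor a (mem_unitBall.mp hq)).symm

lemma represents_mobius {u : (RegularSeries ℍ[ℝ])ˣ}
    (hu : (u : RegularSeries ℍ[ℝ]) = reflFactor a) :
    Represents (linFactor a * ↑u⁻¹) (mobius a) :=
  (represents_linFactor a).rightQuot (hu ▸ represents_reflFactor a)

end Factors

section DifferenceQuotients

open RegularSeries

variable {a : ℍ[ℝ]} {φ γ : RegularSeries ℍ[ℝ]} {f g : ℍ[ℝ] → ℍ[ℝ]}

lemma Represents.leftQuot_sub_eq (h : Represents (C (f a) + linFactor a * γ) f) {q : ℍ[ℝ]}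
    (hq : q ∈ unitBall) (hne : symmetrization (fun p => p - a) q ≠ 0) :
    leftQuot (fun p => p - a) (fun p => f p - f a) q = γ.eval q :=
  (represents_linFactor a).leftQuot_eq
    (by simpa only [add_sub_cancel_left] using h.sub (represents_const (f a))) hq hne

lemma IsDiffQuot.represents (hg : IsDiffQuot a f g)
    (h : Represents (C (f a) + linFactor a * γ) f) : Represents γ g := by
  obtain ⟨γ', hγ'⟩ := hg.1.exists_represents
  have hsa := isSelfAdjoint_symm (linFactor a)
  suffices heq : symm (linFactor a) * γ' = symm (linFactor a) * γ by
    rwa [mul_left_cancel₀ (mul_ne_zero (linFactor_ne_zero a) ?_) heq] at hγ'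
    rw [star_linFactor]
    exact linFactor_ne_zero _
  refine ext_of_eval_coe_eq fun x hx => ?_
  have hx' : ‖(x : ℍ[ℝ])‖ < 1 := by rwa [Quaternion.norm_coe]
  rw [eval_mul_of_isSelfAdjoint hsa γ' hx', eval_mul_of_isSelfAdjoint hsa γ hx',
    ← (represents_linFactor a).symmetrization_eq, mul_eq_mul_left_iff, or_iff_not_imp_right]
  intro hne
  rw [← hγ' (mem_unitBall.mpr hx'), hg.2 _ (mem_unitBall.mpr hx') hne,
    h.leftQuot_sub_eq (mem_unitBall.mpr hx') hne]

lemma Represents.diffQuot (h : Represents φ f) (ha : ‖a‖ < 1) :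
    ∃ γ, Represents γ (diffQuot a f) ∧ φ = C (f a) + linFactor a * γ := by
  obtain ⟨γ, hγ⟩ := φ.exists_eq_C_add_linFactor_mul ha
  rw [← h (mem_unitBall.mpr ha)] at hγ
  have hf : Represents (C (f a) + linFactor a * γ) f := hγ ▸ h
  have hex : ∃ g, IsDiffQuot a f g :=
    ⟨γ.eval, (represents_eval γ).sliceRegular, fun _ hq hne => (hf.leftQuot_sub_eq hq hne).symm⟩
  refine ⟨γ, ?_, hγ⟩
  rw [SliceRegularBall.diffQuot, dif_pos hex]
  exact hex.choose_spec.represents hf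

lemma Represents.diffQuot_diffQuot (h : Represents φ f) (ha : ‖a‖ < 1)
    (hzero : SliceRegularBall.diffQuot a f (star a) = 0) :
    ∃ γ, Represents γ (SliceRegularBall.diffQuot (star a) (SliceRegularBall.diffQuot a f)) ∧
      φ = C (f a) + symm (linFactor a) * γ := by
  obtain ⟨γ, hγ, hφ⟩ := h.diffQuot ha
  obtain ⟨δ, hδ, hγδ⟩ := hγ.diffQuot (a := star a) (by rwa [Quaternion.norm_star])
  rw [hzero, map_zero, zero_add] at hγδ
  exact ⟨δ, hδ, by rw [symm_apply, mul_assoc, star_linFactor, ← hγδ, ← hφ]⟩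

lemma sphericalCoeff_two_mul (f : ℍ[ℝ] → ℍ[ℝ]) (a : ℍ[ℝ]) (n : ℕ) :
    sphericalCoeff f a (2 * n) = iterDiffQuot a n f a := by
  simp [sphericalCoeff]

lemma sphericalCoeff_two_mul_add_one (f : ℍ[ℝ] → ℍ[ℝ]) (a : ℍ[ℝ]) (n : ℕ) :
    sphericalCoeff f a (2 * n + 1) = diffQuot a (iterDiffQuot a n f) (star a) := by
  rw [sphericalCoeff, if_neg (by simp), show (2 * n + 1) / 2 = n by lia]

lemma iterDiffQuot_succ (f : ℍ[ℝ] → ℍ[ℝ]) (a : ℍ[ℝ]) (n : ℕ) :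
    iterDiffQuot a (n + 1) f = diffQuot (star a) (diffQuot a (iterDiffQuot a n f)) :=
  Function.iterate_succ_apply' ..

lemma Represents.iterDiffQuot (h : Represents φ f) (ha : ‖a‖ < 1) {n : ℕ} (hn : 1 ≤ n)
    (hA : ∀ m, 1 ≤ m → m ≤ 2 * n - 1 → sphericalCoeff f a m = 0) :
    ∃ γ, Represents γ (iterDiffQuot a n f) ∧ φ = C (f a) + symm (linFactor a) ^ n * γ := by
  induction n, hn using Nat.le_induction with
  | base =>
    have hodd := hA (2 * 0 + 1) le_rfl le_rfl
    rw [sphericalCoeff_two_mul_add_one] at hodd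
    rw [pow_one]
    exact h.diffQuot_diffQuot ha hodd
  | succ n hn ih =>
    obtain ⟨γ, hγ, hφ⟩ := ih fun m h₁ h₂ => hA m h₁ (by lia)
    have heven := hA (2 * n) (by lia) (by lia)
    have hodd := hA (2 * n + 1) (by lia) (by lia)
    rw [sphericalCoeff_two_mul] at heven
    rw [sphericalCoeff_two_mul_add_one] at hodd
    obtain ⟨δ, hδ, hγδ⟩ := hγ.diffQuot_diffQuot ha hodd
    rw [heven, map_zero, zero_add] at hγδ
    exact ⟨δ, by rwa [iterDiffQuot_succ], by rw [pow_succ, mul_assoc, ← hγδ, ← hφ]⟩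

end DifferenceQuotients

section MobiusEstimates

variable {a q : ℍ[ℝ]}

lemma norm_one_sub_mul_star_le (ha : ‖a‖ < ‖q‖) (hq : ‖q‖ < 1) :
    ‖1 - q * star a‖ ≤ (1 + (1 - ‖q‖ ^ 2) / (‖q‖ - ‖a‖)) * ‖q - a‖ := by
  have hsplit : 1 - q * star a = ((1 - ‖q‖ ^ 2 : ℝ) : ℍ[ℝ]) + q * star (q - a) := by
    rw [star_sub, mul_sub, Quaternion.self_mul_star, Quaternion.normSq_eq_norm_mul_self, ← sq,
      Quaternion.coe_sub, Quaternion.coe_one, sub_add_sub_cancel]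
  have hnonneg : 0 ≤ 1 - ‖q‖ ^ 2 := sub_nonneg.mpr (pow_le_one₀ (norm_nonneg q) hq.le)
  have hpos : 0 < ‖q‖ - ‖a‖ := sub_pos.mpr ha
  calc ‖1 - q * star a‖ ≤ (1 - ‖q‖ ^ 2) + ‖q‖ * ‖q - a‖ := by
        rw [hsplit]
        refine (norm_add_le _ _).trans_eq ?_
        rw [norm_mul, Quaternion.norm_star, Quaternion.norm_coe, Real.norm_of_nonneg hnonneg]
    _ ≤ (1 - ‖q‖ ^ 2) / (‖q‖ - ‖a‖) * ‖q - a‖ + 1 * ‖q - a‖ := by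
        gcongr
        rw [div_mul_eq_mul_div, le_div_iff₀ hpos]
        exact mul_le_mul_of_nonneg_left (norm_sub_norm_le q a) hnonneg
    _ = _ := by ring

lemma norm_sub_le_norm_one_sub_mul_star (hq : ‖q‖ ≤ 1) (ha : ‖a‖ ≤ 1) :
    ‖q - a‖ ≤ ‖1 - q * star a‖ := by
  have hid : ‖1 - q * star a‖ ^ 2 = ‖q - a‖ ^ 2 + (1 - ‖q‖ ^ 2) * (1 - ‖a‖ ^ 2) := by
    simp only [sq, ← Quaternion.normSq_eq_norm_mul_self, Quaternion.normSq_def',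
      Quaternion.re_sub, Quaternion.imI_sub, Quaternion.imJ_sub, Quaternion.imK_sub,
      Quaternion.re_mul, Quaternion.imI_mul, Quaternion.imJ_mul, Quaternion.imK_mul,
      Quaternion.re_star, Quaternion.imI_star, Quaternion.imJ_star, Quaternion.imK_star,
      Quaternion.re_one, Quaternion.imI_one, Quaternion.imJ_one, Quaternion.imK_one]
    ring
  rw [← sq_le_sq₀ (norm_nonneg _) (norm_nonneg _), hid]
  exact le_add_of_nonneg_right (mul_nonneg (sub_nonneg.mpr (pow_le_one₀ (norm_nonneg q) hq))
    (sub_nonneg.mpr (pow_le_one₀ (norm_nonneg a) ha)))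

end MobiusEstimates

section SchurClass

namespace RegularSeries

/-- The Schur class: series bounded by `1` on the open unit ball. -/
def IsSchur (φ : RegularSeries ℍ[ℝ]) : Prop := ∀ q, ‖q‖ < 1 → ‖eval φ q‖ ≤ 1

variable {a c : ℍ[ℝ]} {φ χ : RegularSeries ℍ[ℝ]}

lemma IsSchur.norm_eval_mul_le (hχ : IsSchur χ) (φ : RegularSeries ℍ[ℝ]) {q : ℍ[ℝ]}
    (hq : ‖q‖ < 1) : ‖eval (φ * χ) q‖ ≤ ‖eval φ q‖ := by
  simpa using φ.norm_eval_mul_le χ hq fun p hp => hχ p (hp.trans_lt hq)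

lemma norm_eval_le_of_norm_eval_mul_le {q : ℍ[ℝ]} (hq : ‖q‖ < 1) (hne : eval (symm φ) q ≠ 0)
    {M : ℝ} (h : ∀ p, ‖p‖ = ‖q‖ → ‖eval (φ * χ) p‖ ≤ M * ‖eval φ p‖) : ‖eval χ q‖ ≤ M := by
  obtain ⟨p, hp, hpne, hmul⟩ := φ.exists_eval_mul_eq hq hne
  have hle := h p hp
  rw [hmul, norm_mul, mul_comm] at hle
  exact le_of_mul_le_mul_right hle (norm_pos_iff.mpr hpne)

section Schwarz

/-- Replacing `q - a` by `1 - q * star a` costs a factor that tends to `1` at the boundary. -/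
lemma IsSchur.norm_eval_reflFactor_mul_le (h : IsSchur (linFactor a * χ)) {q : ℍ[ℝ]}
    (ha : ‖a‖ < ‖q‖) (hq : ‖q‖ < 1) :
    ‖eval (reflFactor a * χ) q‖ ≤ 1 + (1 - ‖q‖ ^ 2) / (‖q‖ - ‖a‖) := by
  refine norm_eval_le_of_norm_eval_mul_le hq (eval_symm_linFactor_ne_zero ha hq) fun p hp => ?_
  have hp₁ : ‖p‖ < 1 := hp.trans_lt hq
  rw [(commute_linFactor_reflFactor (star_comm_self' a).symm).left_comm, eval_linFactor a hp₁]
  refine (h.norm_eval_mul_le _ hp₁).trans ?_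
  rw [eval_reflFactor a hp₁, ← hp]
  exact norm_one_sub_mul_star_le (hp ▸ ha) hp₁

lemma IsSchur.reflFactor_mul (ha : ‖a‖ < 1) (h : IsSchur (linFactor a * χ)) :
    IsSchur (reflFactor a * χ) := by
  intro q hq
  have hlim : Filter.Tendsto (fun ρ : ℝ => 1 + (1 - ρ ^ 2) / (ρ - ‖a‖))
      (nhdsWithin 1 (Set.Iio 1)) (nhds (1 + (1 - 1 ^ 2) / (1 - ‖a‖))) := by
    refine Filter.Tendsto.mono_left (ContinuousAt.tendsto ?_) nhdsWithin_le_nhds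
    fun_prop (disch := exact (sub_pos.mpr ha).ne')
  rw [one_pow, sub_self, zero_div, add_zero] at hlim
  refine ge_of_tendsto hlim ?_
  filter_upwards [Ioo_mem_nhdsLT (max_lt ha hq)] with ρ hρ
  refine norm_eval_le_of_sphere _ hρ.2 (fun p hp => ?_) ((le_max_right _ _).trans_lt hρ.1)
  rw [← hp] at hρ ⊢
  exact h.norm_eval_reflFactor_mul_le ((le_max_left _ _).trans_lt hρ.1) hρ.2

lemma IsSchur.symm_reflFactor_mul (ha : ‖a‖ < 1) (h : IsSchur (symm (linFactor a) * χ)) :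
    IsSchur (symm (reflFactor a) * χ) := by
  rw [symm_apply, star_linFactor, mul_assoc] at h
  replace h := h.reflFactor_mul ha
  rw [← (commute_linFactor_reflFactor (Commute.refl (star a))).left_comm] at h
  replace h := h.reflFactor_mul (by rwa [Quaternion.norm_star])
  rwa [← star_reflFactor, ← mul_assoc, star_comm_self' (reflFactor a), ← symm_apply] at h

lemma IsSchur.symm_reflFactor_pow_mul (ha : ‖a‖ < 1) (n : ℕ)
    (h : IsSchur (symm (linFactor a) ^ n * χ)) : IsSchur (symm (reflFactor a) ^ n * χ) := by
  induction n generalizing χ with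
  | zero => simpa using h
  | succ n ih =>
    rw [pow_succ', mul_assoc] at h
    rw [pow_succ, mul_assoc]
    refine ih ?_
    rw [← (commute_of_isSelfAdjoint (isSelfAdjoint_symm (reflFactor a)) _).left_comm]
    exact h.symm_reflFactor_mul ha

end Schwarz

section SchwarzPick

/-- This turns the right quotient `(φ - c) * (1 - star c * φ)^{-*}` into a left quotient whose
numerator and denominator are functions of `φ(q)` alone. -/
lemma one_sub_mul_C_star_mul_sub_C (φ : RegularSeries ℍ[ℝ]) (c : ℍ[ℝ]) :
    (1 - φ * C (star c)) * (φ - C c) = (φ - C c) * (1 - C (star c) * φ) := by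
  have hcomm : C c * (C (star c) * φ) = φ * (C (star c) * C c) := by
    rw [← mul_assoc, ← star_C, ← star_comm_self' (C c),
      (commute_of_isSelfAdjoint (.star_mul_self _) φ).eq]
  simp only [sub_mul, mul_sub, one_mul, mul_one, mul_assoc, hcomm]
  abel

lemma IsSchur.exists_unit_isSchur_sub_C_mul (hφ : IsSchur φ) (hc : ‖c‖ < 1) :
    ∃ v : (RegularSeries ℍ[ℝ])ˣ, (v : RegularSeries ℍ[ℝ]) = 1 - C (star c) * φ ∧
      IsSchur ((φ - C c) * ↑v⁻¹) := by
  obtain ⟨v, hv⟩ := isUnit_one_sub (C (star c) * φ) hc fun q hq => by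
    simpa using hφ.norm_eval_mul_le (C (star c)) hq
  have hmulC {q : ℍ[ℝ]} (hq : ‖q‖ < 1) : eval (φ * C (star c)) q = eval φ q * star c :=
    φ.eval_mul_C _ hq
  have hunit : IsUnit (1 - φ * C (star c)) := isUnit_one_sub _ hc fun q hq => by
    rw [hmulC hq, norm_mul, Quaternion.norm_star]
    exact mul_le_of_le_one_left (norm_nonneg _) (hφ q hq)
  refine ⟨v, hv, fun q hq => norm_eval_le_of_norm_eval_mul_le (φ := 1 - φ * C (star c)) hq
    (eval_symm_ne_zero_of_isUnit hunit hq) fun p hp => ?_⟩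
  have hp₁ : ‖p‖ < 1 := hp.trans_lt hq
  rw [← mul_assoc, one_sub_mul_C_star_mul_sub_C, ← hv, Units.mul_inv_cancel_right, one_mul,
    eval_sub _ _ hp₁, eval_sub _ _ hp₁, eval_C, eval_one, hmulC hp₁]
  exact norm_sub_le_norm_one_sub_mul_star (hφ p hp₁) hc.le

end SchwarzPick

end RegularSeries

end SchurClass

section Bounds

namespace RegularSeries

variable {a q : ℍ[ℝ]} {χ : RegularSeries ℍ[ℝ]} {n : ℕ}

lemma norm_eval_symm_pow_mul (φ χ : RegularSeries ℍ[ℝ]) (n : ℕ) (hq : ‖q‖ < 1) :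
    ‖eval (symm φ ^ n * χ) q‖ = ‖eval (symm φ) q‖ ^ n * ‖eval χ q‖ := by
  have hsa := isSelfAdjoint_symm φ
  rw [eval_mul_of_isSelfAdjoint (hsa.pow n) χ hq, eval_pow_of_isSelfAdjoint hsa n hq, norm_mul,
    norm_pow]

lemma norm_eval_symm_linFactor (ha : ‖a‖ < 1) (hq : ‖q‖ < 1) :
    ‖eval (symm (linFactor a)) q‖
      = ‖symmetrization (mobius a) q‖ * ‖eval (symm (reflFactor a)) q‖ := by
  obtain ⟨u, hu⟩ := isUnit_reflFactor ha
  rw [(represents_mobius hu).symmetrization_eq, ← norm_mul,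
    ← eval_mul_of_isSelfAdjoint (isSelfAdjoint_symm _) _ hq, ← map_mul, ← hu,
    Units.inv_mul_cancel_right]

lemma norm_eval_symm_linFactor_pow_mul (χ : RegularSeries ℍ[ℝ]) (n : ℕ) (ha : ‖a‖ < 1)
    (hq : ‖q‖ < 1) : ‖eval (symm (linFactor a) ^ n * χ) q‖
      = ‖symmetrization (mobius a) q‖ ^ n * ‖eval (symm (reflFactor a) ^ n * χ) q‖ := by
  rw [norm_eval_symm_pow_mul _ _ _ hq, norm_eval_symm_pow_mul _ _ _ hq,
    norm_eval_symm_linFactor ha hq, mul_pow, mul_assoc]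

lemma norm_eval_eq_zpow_mul (χ : RegularSeries ℍ[ℝ]) (n : ℕ) (ha : ‖a‖ < 1) (hq : ‖q‖ < 1) :
    ‖eval χ q‖ = ‖(1 - q * a.re) ^ 2 + (q * ‖a.im‖) ^ 2‖ ^ (-(n : ℤ))
      * ‖eval (symm (reflFactor a) ^ n * χ) q‖ := by
  have hne := eval_symm_ne_zero_of_isUnit (isUnit_reflFactor ha) hq
  rw [norm_eval_symm_pow_mul _ _ _ hq, ← eval_symm_reflFactor a hq, zpow_neg, zpow_natCast,
    inv_mul_cancel_left₀ (pow_ne_zero n (norm_ne_zero_iff.mpr hne))]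

namespace IsSchur

lemma norm_eval_le_norm_mobius (ha : ‖a‖ < 1) (h : IsSchur (linFactor a * χ)) (hq : ‖q‖ < 1) :
    ‖eval (linFactor a * χ) q‖ ≤ ‖mobius a q‖ := by
  obtain ⟨u, hu⟩ := isUnit_reflFactor ha
  rw [represents_mobius hu (mem_unitBall.mpr hq)]
  simpa only [← hu, mul_assoc, Units.inv_mul_cancel_left] using
    (h.reflFactor_mul ha).norm_eval_mul_le (linFactor a * ↑u⁻¹) hq

lemma norm_eval_le_norm_regRecip (ha : ‖a‖ < 1) (h : IsSchur (linFactor a * χ)) (hq : ‖q‖ < 1) :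
    ‖eval χ q‖ ≤ ‖regRecip (fun p => 1 - p * star a) q‖ := by
  obtain ⟨u, hu⟩ := isUnit_reflFactor ha
  rw [(hu ▸ represents_reflFactor a : Represents u _).regRecip (mem_unitBall.mpr hq)]
  simpa only [← hu, Units.inv_mul_cancel_left] using
    (h.reflFactor_mul ha).norm_eval_mul_le ↑u⁻¹ hq

lemma linFactor_mul_symm_reflFactor_pow_mul (ha : ‖a‖ < 1)
    (h : IsSchur (symm (linFactor a) ^ n * (linFactor a * χ))) :
    IsSchur (linFactor a * (symm (reflFactor a) ^ n * χ)) := by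
  rw [← (commute_of_isSelfAdjoint ((isSelfAdjoint_symm (reflFactor a)).pow n) _).left_comm]
  exact h.symm_reflFactor_pow_mul ha n

lemma norm_eval_symm_linFactor_pow_mul_le (ha : ‖a‖ < 1)
    (h : IsSchur (symm (linFactor a) ^ n * χ)) (hq : ‖q‖ < 1) :
    ‖eval (symm (linFactor a) ^ n * χ) q‖ ≤ ‖symmetrization (mobius a) q‖ ^ n := by
  rw [norm_eval_symm_linFactor_pow_mul χ n ha hq]
  exact mul_le_of_le_one_right (by positivity) (h.symm_reflFactor_pow_mul ha n q hq)

lemma norm_eval_le_zpow (ha : ‖a‖ < 1) (h : IsSchur (symm (linFactor a) ^ n * χ))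
    (hq : ‖q‖ < 1) :
    ‖eval χ q‖ ≤ ‖(1 - q * a.re) ^ 2 + (q * ‖a.im‖) ^ 2‖ ^ (-(n : ℤ)) := by
  rw [norm_eval_eq_zpow_mul χ n ha hq]
  exact mul_le_of_le_one_right (by positivity) (h.symm_reflFactor_pow_mul ha n q hq)

lemma norm_eval_symm_linFactor_pow_mul_linFactor_mul_le (ha : ‖a‖ < 1)
    (h : IsSchur (symm (linFactor a) ^ n * (linFactor a * χ))) (hq : ‖q‖ < 1) :
    ‖eval (symm (linFactor a) ^ n * (linFactor a * χ)) q‖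
      ≤ ‖symmetrization (mobius a) q‖ ^ n * ‖mobius a q‖ := by
  rw [norm_eval_symm_linFactor_pow_mul _ n ha hq,
    (commute_of_isSelfAdjoint ((isSelfAdjoint_symm (reflFactor a)).pow n) _).left_comm]
  gcongr
  exact (h.linFactor_mul_symm_reflFactor_pow_mul ha).norm_eval_le_norm_mobius ha hq

lemma norm_eval_le_zpow_mul_norm_regRecip (ha : ‖a‖ < 1)
    (h : IsSchur (symm (linFactor a) ^ n * (linFactor a * χ))) (hq : ‖q‖ < 1) :
    ‖eval χ q‖ ≤ ‖(1 - q * a.re) ^ 2 + (q * ‖a.im‖) ^ 2‖ ^ (-(n : ℤ))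
      * ‖regRecip (fun p => 1 - p * star a) q‖ := by
  rw [norm_eval_eq_zpow_mul χ n ha hq]
  gcongr
  exact (h.linFactor_mul_symm_reflFactor_pow_mul ha).norm_eval_le_norm_regRecip ha hq

end IsSchur

end RegularSeries

end Bounds

end SliceRegularBall

end

theorem mainTheorem7 (f : ℍ[ℝ] → ℍ[ℝ]) (hf : SliceRegular f)
    (hmaps : Set.MapsTo f unitBall unitBall)
    (q₀ : ℍ[ℝ]) (hq₀ : q₀ ∈ unitBall) (x₀ y₀ : ℝ) (hx₀ : x₀ = q₀.re) (hy₀ : y₀ = ‖q₀.im‖)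
    (n : ℕ) (hn : 1 ≤ n)
    (hA : ∀ m : ℕ, 1 ≤ m → m ≤ 2 * n - 1 → sphericalCoeff f q₀ m = 0) :
    (∀ q ∈ unitBall,
      ‖rightQuot (fun p => f p - f q₀) (schwarzDenom f q₀) q‖
          ≤ ‖symmetrization (mobius q₀) q‖ ^ n ∧
      ‖rightQuot (iterDiffQuot q₀ n f) (schwarzDenom f q₀) q‖
          ≤ ‖(1 - q * (x₀ : ℍ[ℝ])) ^ 2 + (q * (y₀ : ℍ[ℝ])) ^ 2‖ ^ (-(n : ℤ))) ∧
    (sphericalCoeff f q₀ (2 * n) = 0 → ∀ q ∈ unitBall,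
      ‖rightQuot (fun p => f p - f q₀) (schwarzDenom f q₀) q‖
          ≤ ‖symmetrization (mobius q₀) q‖ ^ n * ‖mobius q₀ q‖ ∧
      ‖rightQuot (diffQuot q₀ (iterDiffQuot q₀ n f)) (schwarzDenom f q₀) q‖
          ≤ ‖(1 - q * (x₀ : ℍ[ℝ])) ^ 2 + (q * (y₀ : ℍ[ℝ])) ^ 2‖ ^ (-(n : ℤ))
            * ‖regRecip (fun p => 1 - p * star q₀) q‖) := by
  subst hx₀ hy₀
  have hball := mem_unitBall.mp hq₀
  obtain ⟨φ, hφ⟩ := hf.exists_represents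
  have hschur : φ.IsSchur := fun q hq => by
    rw [← hφ (mem_unitBall.mpr hq)]
    exact (mem_unitBall.mp (hmaps (mem_unitBall.mpr hq))).le
  obtain ⟨Φ, hΦ, hexpansion⟩ := hφ.iterDiffQuot hball hn hA
  obtain ⟨v, hv, hnum⟩ := hschur.exists_unit_isSchur_sub_C_mul (mem_unitBall.mp (hmaps hq₀))
  have hden : Represents v (schwarzDenom f q₀) := by
    rw [hv, ← map_one RegularSeries.C]
    exact (represents_const 1).sub ((represents_const _).regMul hφ)
  have hquot := (hφ.sub (represents_const (f q₀))).rightQuot hden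
  rw [hexpansion, add_sub_cancel_left, mul_assoc] at hnum hquot
  refine ⟨fun q hq => ?_, fun hA₂ q hq => ?_⟩
  · rw [hquot hq, hΦ.rightQuot hden hq]
    rw [mem_unitBall] at hq
    exact ⟨hnum.norm_eval_symm_linFactor_pow_mul_le hball hq, hnum.norm_eval_le_zpow hball hq⟩
  · obtain ⟨Ψ, hΨ, hdiv⟩ := hΦ.diffQuot hball
    rw [← sphericalCoeff_two_mul, hA₂, map_zero, zero_add] at hdiv
    rw [hdiv, mul_assoc] at hnum hquot
    rw [hquot hq, hΨ.rightQuot hden hq]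
    rw [mem_unitBall] at hq
    exact ⟨hnum.norm_eval_symm_linFactor_pow_mul_linFactor_mul_le hball hq,
      hnum.norm_eval_le_zpow_mul_norm_regRecip hball hq⟩
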